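/- Let $K\ge 2$ be the vocabulary size, $\Delta_K$ the probability simplex in $\mathbb R^K$, and for $\delta>0$ let $\Delta_K^\delta=\{\mathbf P\in\Delta_K:\max_w P_w\le 1-\delta\}$. A calibrator is a function $g:[0,1]\to[0,\infty)$ that is decreasing (in the weak sense) on $(0,1]$ and satisfies $\int_0^1 g(p)\,dp=1$ (the value $g(0)$ is immaterial, so $g(p)=-\log p$ with any finite value at $0$ is allowed). Gumbel-max watermark (alternative hypothesis). On a probability space $(\Omega,\mathcal A,\mathbb Q)$ with a filtration $(\mathcal F_t)_{t\ge 0}$, for every $t\ge 1$: the next-token probability (NTP) vector $\mathbf P_t=(P_{t,1},\dots,P_{t,K})$ is $\mathcal F_{t-1}$-measurable; $\zeta_t=(U_{t,1},\dots,U_{t,K})$ is uniformly distributed on $[0,1]^K$ and independent of $\mathcal F_{t-1}$; the token $W_t$ almost surely satisfies $$W_t\in\operatorname*{arg\,max}_{w\in\{1,\dots,K\}}\frac{\log U_{t,w}}{P_{t,w}}$$ (the quotient being $-\infty$ if $P_{t,w}=0$); and $Y_t=U_{t,W_t}$ is $\mathcal F_t$-measurable. **Theorem.** Let $\delta>0$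 and let $g$ be a calibrator that is nonconstant on $(0,1)$ (equivalently, not almost everywhere constant). There exists $\lambda\in(0,1)$, depending only on $\delta$ and $g$, such that the following holds for every $K\ge 2$, every integer $m\ge 0$ and every Gumbel-max watermark model as above in which $\mathbf P_t\in\Delta_K^\delta$ almost surely for each $t\ge1$ and $(\mathbf P_t)_{t\ge 1}$ is $m$-dependent, i.e. $\sigma(\mathbf P_t:1\le t\le t_1)$ and $\sigma(\mathbf P_t:t\ge t_2)$ are independent under $\mathbb Q$ whenever $t_1\ge 1$ and $t_2-t_1>m$. The process $$M_t=\prod_{s=1}^t\bigl(1-\lambda+\lambda g(1-Y_s)\bigr),\qquad t\ge 0,$$ satisfies $$\liminf_{T\to\infty}\frac1T\log M_T>0\qquad \mathbb Q\text{-almost surely}.$$ In particular, for every $\alpha\in(0,1)$ the online test at level $\alpha$ is consistent: $$\mathbb Q\Bigl(\sup_{1\le t\le T}M_t\ge \tfrac1\alpha\Bigr)\to 1\qquad\text{as }T\to\infty .$$ -/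

import Mathlib

open MeasureTheory ProbabilityTheory Filter Topology

noncomputable section

namespace Watermark

/-- A calibrator: a nonnegative decreasing function on `[0,1]` with integral `1` (equal to `1`, so `g`
is automatically integrable). Monotonicity is only asked on `(0,1]`, so that `g 0` may be any
nonnegative number; this way calibrators that blow up at `0`, such as `p ↦ -log p`, are included
with an arbitrary finite value at the irrelevant point `0`. Values outside `[0,1]` play no role. -/
structure IsCalibrator (g : ℝ → ℝ) : Prop where
  nonneg : ∀ p ∈ Set.Icc (0 : ℝ) 1, 0 ≤ g p
  antitone : AntitoneOn g (Set.Ioc 0 1)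
  integral_eq_one : ∫ p in Set.Icc (0 : ℝ) 1, g p = 1

/-- `g` is nonconstant on the open unit interval; for a decreasing function this says that
`g` is not almost everywhere equal to a constant on `[0,1]`. -/
def NonconstantOnUnit (g : ℝ → ℝ) : Prop :=
  ∃ p ∈ Set.Ioo (0 : ℝ) 1, ∃ q ∈ Set.Ioo (0 : ℝ) 1, g p ≠ g q

/-- The probability vectors in `ℝ^K` all of whose components are at most `1 - δ`. -/
def simplexDelta (K : ℕ) (δ : ℝ) : Set (Fin K → ℝ) :=
  {p | p ∈ stdSimplex ℝ (Fin K) ∧ ∀ w, p w ≤ 1 - δ}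

/-- The extended real number `log u / p`, with the conventions that `log 0 = -∞` and that the
quotient is `-∞` when `p = 0` (a token of probability zero is not selected). -/
def gumbelScore (p u : ℝ) : EReal :=
  if 0 < p ∧ 0 < u then ((Real.log u / p : ℝ) : EReal) else ⊥

/-- `w` is a maximizer of `v ↦ log (u v) / p v`. Ties may be broken in any way. -/
def IsGumbelArgmax {K : ℕ} (p u : Fin K → ℝ) (w : Fin K) : Prop :=
  ∀ v, gumbelScore (p v) (u v) ≤ gumbelScore (p w) (u w)

/-- The pivotal statistic `Y_t = U_{t, W_t}`. -/
def pivotal {Ω : Type*} {K : ℕ} (ζ : ℕ → Ω → Fin K → ℝ) (W : ℕ → Ω → Fin K) (t : ℕ) (ω : Ω) : ℝ :=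
  ζ t ω (W t ω)

/-- Generation of tokens `W 1, W 2, …` by an LLM with the Gumbel-max watermark, that is, the
alternative hypothesis, under the probability `Q`. Time starts at `1`; the values of the sequences at
index `0` are not used. `P t` is the vector of next-token probabilities for the `t`-th token,
`ζ t` is the pseudo-random vector that generates it, and `ℱ t` is the information available after
`t` tokens. -/
structure IsGumbelMaxModel {Ω : Type*} {mΩ : MeasurableSpace Ω} (Q : Measure Ω)
    (ℱ : Filtration ℕ mΩ) {K : ℕ} (P ζ : ℕ → Ω → Fin K → ℝ) (W : ℕ → Ω → Fin K) : Prop where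
  /-- `P_t` is known before the `t`-th token is generated. -/
  predictable : ∀ t, Measurable[ℱ t] (P (t + 1))
  measurable_seed : ∀ t, Measurable (ζ (t + 1))
  /-- `ζ_t` is uniformly distributed on `[0,1]^K`. -/
  seed_uniform : ∀ t, Measure.map (ζ (t + 1)) Q =
    Measure.pi (fun _ : Fin K => (volume : Measure ℝ).restrict (Set.Icc 0 1))
  /-- `ζ_t` is independent of the past. -/
  seed_indep : ∀ t, Indep (MeasurableSpace.comap (ζ (t + 1)) inferInstance) (ℱ t) Q
  /-- The `t`-th token is the output of the Gumbel-max decoder. -/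
  token : ∀ t, ∀ᵐ ω ∂Q, IsGumbelArgmax (P (t + 1) ω) (ζ (t + 1) ω) (W (t + 1) ω)
  /-- `(Y_t)` is adapted. -/
  adapted : ∀ t, Measurable[ℱ (t + 1)] (pivotal ζ W (t + 1))

/-- `m`-dependence of a sequence `X 1, X 2, …`: the σ-algebras `σ(X_t : t ≤ t₁)` and
`σ(X_t : t ≥ t₂)` are independent when `t₂ - t₁ > m`. -/
def IsMDependent {Ω E : Type*} [MeasurableSpace E] {mΩ : MeasurableSpace Ω} (Q : Measure Ω)
    (m : ℕ) (X : ℕ → Ω → E) : Prop :=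
  ∀ t₁ t₂ : ℕ, 1 ≤ t₁ → t₁ + m < t₂ →
    Indep (⨆ t ∈ Set.Icc 1 t₁, MeasurableSpace.comap (X t) inferInstance)
      (⨆ t ∈ Set.Ici t₂, MeasurableSpace.comap (X t) inferInstance) Q

/-- The nonadaptive process `M_t = ∏_{s=1}^t (1 - lam + lam * g (1 - Y_s))`. -/
def nonadaptive {Ω : Type*} (g : ℝ → ℝ) (lam : ℝ) (Y : ℕ → Ω → ℝ) (t : ℕ) (ω : Ω) : ℝ :=
  ∏ s ∈ Finset.Icc 1 t, (1 - lam + lam * g (1 - Y s ω))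

/-- The asymptotic growth rate `liminf_{T → ∞} (1/T) log M_T`, with values in `[-∞, ∞]`. -/
def growthRate {Ω : Type*} (M : ℕ → Ω → ℝ) (ω : Ω) : EReal :=
  liminf (fun T : ℕ => ((1 / (T : ℝ) * Real.log (M T ω) : ℝ) : EReal)) atTop

/-- The online test that rejects once `M` reaches `1/α` is consistent under `Q`:
`Q (sup_{1 ≤ t ≤ T} M_t ≥ 1/α) → 1` as `T → ∞`. -/
def IsConsistentTest {Ω : Type*} {mΩ : MeasurableSpace Ω} (Q : Measure Ω) (M : ℕ → Ω → ℝ)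
    (α : ℝ) : Prop :=
  Tendsto (fun T : ℕ => Q {ω | ((1 / α : ℝ) : EReal) ≤ ⨆ t ∈ Finset.Icc 1 T, (M t ω : EReal)})
    atTop (𝓝 1)

end Watermark

end

/-!
Given the past, the variable `V = max {U_w ^ (1 / P_w) : P_w > 0}` is uniform on `[0,1]`, because
`{V ≤ v}` is a box of volume `∏ v ^ P_w = v`. The selected token attains this maximum, so
`Y = V ^ P_W`, and `P_W ≤ 1 - δ` gives `Y ≥ V ^ (1 - δ)` pathwise (`gumbelMax_rpow_le`). As `g` is
decreasing, the betting factor `1 - lam + lam * g (1 - Y)` is therefore at least its value at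
`V ^ (1 - δ)`, whose law no longer depends on the past, on `K`, or on the probability vectors.

Since `V ^ (1 - δ) > V` and `g` is nonconstant, the mean of `g (1 - V ^ (1 - δ))` exceeds
`∫ g = 1` (`IsCalibrator.one_lt_lintegral`). After truncating `g`, the bound
`1 / (1 + x) ≤ 1 - x + 2 * x ^ 2` shows that for small `lam` the mean `ρ` of the reciprocal factor
at `V ^ (1 - δ)` is below `1` (`IsCalibrator.exists_lam`). Conditioning on the past one step at a
time gives `E (1 / M_T) ≤ ρ ^ T` (`IsGumbelMaxModel.lintegral_invWealth_le`), so by Markov's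
inequality and Borel–Cantelli there is `r > 1` such that almost surely `M_T > r ^ T` for all large
`T`. Both conclusions follow: `log r` bounds the growth rate from below, and `M` almost surely
crosses every level.
-/

noncomputable section

namespace Watermark

/-! ### The Gumbel maximum -/

/-- The Gumbel-max statistic `max {u w ^ (1 / p w) : p w > 0}`, the exponential of the maximal
Gumbel score. Tokens of probability zero contribute `0`, which never affects the maximum of
nonnegative numbers. -/
def gumbelMax {K : ℕ} (p u : Fin K → ℝ) : ℝ :=
  ⨆ w, if 0 < p w then u w ^ (1 / p w) else 0

lemma measurable_gumbelMax {K : ℕ} :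
    Measurable fun x : (Fin K → ℝ) × (Fin K → ℝ) => gumbelMax x.1 x.2 := by
  unfold gumbelMax
  refine Measurable.iSup fun w => ?_
  refine Measurable.ite (measurableSet_lt measurable_const (by fun_prop)) ?_ measurable_const
  fun_prop

lemma gumbelMax_le_iff {K : ℕ} [NeZero K] {p u : Fin K → ℝ} {c : ℝ} :
    gumbelMax p u ≤ c ↔ ∀ w, (if 0 < p w then u w ^ (1 / p w) else 0) ≤ c :=
  ciSup_le_iff (Set.finite_range _).bddAbove

lemma gumbelMax_nonneg {K : ℕ} {p u : Fin K → ℝ} (hu : ∀ w, 0 ≤ u w) : 0 ≤ gumbelMax p u := by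
  refine Real.iSup_nonneg fun w => ?_
  split_ifs
  · exact Real.rpow_nonneg (hu w) _
  · exact le_rfl

lemma volume_restrict_Icc_Iic {x : ℝ} (hx1 : x ≤ 1) :
    (volume.restrict (Set.Icc (0 : ℝ) 1)) (Set.Iic x) = ENNReal.ofReal x := by
  have : Set.Iic x ∩ Set.Icc 0 1 = Set.Icc 0 x := by
    ext y
    simp only [Set.mem_inter_iff, Set.mem_Iic, Set.mem_Icc]
    exact ⟨fun h => ⟨h.2.1, h.1⟩, fun h => ⟨h.2, h.1, h.2.trans hx1⟩⟩
  rw [Measure.restrict_apply measurableSet_Iic, this, Real.volume_Icc, sub_zero]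

lemma ae_restrict_Icc_mem_Ioo :
    ∀ᵐ x ∂(volume.restrict (Set.Icc (0 : ℝ) 1)), x ∈ Set.Ioo (0 : ℝ) 1 := by
  rw [← Measure.restrict_congr_set Ioo_ae_eq_Icc]
  exact ae_restrict_mem measurableSet_Ioo

instance : IsProbabilityMeasure ((volume : Measure ℝ).restrict (Set.Icc 0 1)) :=
  ⟨by simp⟩

lemma ae_pi_mem_Ioo (K : ℕ) :
    ∀ᵐ u ∂(Measure.pi fun _ : Fin K => (volume : Measure ℝ).restrict (Set.Icc 0 1)),
      ∀ w, u w ∈ Set.Ioo (0 : ℝ) 1 :=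
  ae_all_iff.2 fun w => (Measure.quasiMeasurePreserving_eval
    (fun _ : Fin K => (volume : Measure ℝ).restrict (Set.Icc 0 1)) w).ae ae_restrict_Icc_mem_Ioo

/-- For a fixed probability vector `p`, the Gumbel maximum of uniform seeds is uniform on `[0,1]`:
the event that it is at most `v` is the box `∏ [0, v ^ p w]`, of volume `v ^ ∑ p w = v`. -/
lemma map_gumbelMax {K : ℕ} [NeZero K] {p : Fin K → ℝ} (hp : p ∈ stdSimplex ℝ (Fin K)) :
    Measure.map (gumbelMax p)
      (Measure.pi fun _ : Fin K => (volume : Measure ℝ).restrict (Set.Icc 0 1)) =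
      (volume : Measure ℝ).restrict (Set.Icc 0 1) := by
  have hm : Measurable (gumbelMax p) :=
    measurable_gumbelMax.comp (measurable_const.prodMk measurable_id)
  have : IsProbabilityMeasure (Measure.map (gumbelMax p)
      (Measure.pi fun _ : Fin K => (volume : Measure ℝ).restrict (Set.Icc 0 1))) :=
    Measure.isProbabilityMeasure_map hm.aemeasurable
  refine Measure.ext_of_Iic _ _ fun v => ?_
  rw [Measure.map_apply hm measurableSet_Iic]
  rcases lt_or_ge v 0 with hv | hv
  · rw [volume_restrict_Icc_Iic (hv.le.trans zero_le_one), ENNReal.ofReal_of_nonpos hv.le]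
    refine measure_mono_null ?_ (ae_iff.1 (ae_pi_mem_Ioo K))
    intro u hu h
    exact absurd ((gumbelMax_nonneg fun w => (h w).1.le).trans hu) (not_le.2 hv)
  rcases lt_or_ge 1 v with hv1 | hv1
  · have h1 : gumbelMax p ⁻¹' Set.Iic v
        =ᵐ[Measure.pi fun _ : Fin K => (volume : Measure ℝ).restrict (Set.Icc 0 1)]
          Set.univ := by
      refine eventuallyEq_set.2 ?_
      filter_upwards [ae_pi_mem_Ioo K] with u hu
      simp only [Set.mem_preimage, Set.mem_Iic, Set.mem_univ, iff_true, gumbelMax_le_iff]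
      intro w
      split_ifs with h
      · exact (Real.rpow_le_one (hu w).1.le (hu w).2.le (by positivity)).trans hv1.le
      · exact hv
    have h2 : (Set.Iic v) =ᵐ[(volume : Measure ℝ).restrict (Set.Icc 0 1)] Set.univ := by
      refine eventuallyEq_set.2 ?_
      filter_upwards [ae_restrict_Icc_mem_Ioo] with x hx
      simpa using hx.2.le.trans hv1.le
    rw [measure_congr h1, measure_congr h2, measure_univ, measure_univ]
  · have h1 : gumbelMax p ⁻¹' Set.Iic v
        =ᵐ[Measure.pi fun _ : Fin K => (volume : Measure ℝ).restrict (Set.Icc 0 1)]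
          Set.univ.pi fun w => Set.Iic (v ^ p w) := by
      refine eventuallyEq_set.2 ?_
      filter_upwards [ae_pi_mem_Ioo K] with u hu
      simp only [Set.mem_preimage, Set.mem_Iic, Set.mem_univ_pi, gumbelMax_le_iff]
      refine forall_congr' fun w => ?_
      split_ifs with h
      · rw [one_div, Real.rpow_inv_le_iff_of_pos (hu w).1.le hv h]
      · have : p w = 0 := le_antisymm (not_lt.1 h) (hp.1 w)
        simp [this, hv, (hu w).2.le]
    rw [measure_congr h1, Measure.pi_pi, volume_restrict_Icc_Iic hv1]
    simp_rw [fun w => volume_restrict_Icc_Iic (Real.rpow_le_one hv hv1 (hp.1 w))]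
    rw [← ENNReal.ofReal_prod_of_nonneg fun w _ => Real.rpow_nonneg hv _]
    congr 1
    rw [← Real.rpow_sum_of_nonneg hv fun w _ => hp.1 w, hp.2, Real.rpow_one]

/-- The pivotal statistic dominates a power of the Gumbel maximum: it equals the maximum to the
power `p w`, where `w` is the chosen token, and `p w ≤ a`. -/
lemma gumbelMax_rpow_le {K : ℕ} [NeZero K] {p u : Fin K → ℝ} {a : ℝ} {w : Fin K}
    (hp : p ∈ stdSimplex ℝ (Fin K)) (hpa : ∀ v, p v ≤ a) (hu : ∀ v, u v ∈ Set.Ioo (0 : ℝ) 1)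
    (hw : IsGumbelArgmax p u w) : gumbelMax p u ^ a ≤ u w := by
  have hpos : ∃ v, 0 < p v := by
    by_contra! h
    have := Finset.sum_nonpos fun v (_ : v ∈ Finset.univ) => h v
    rw [hp.2] at this
    linarith
  obtain ⟨v₀, hv₀⟩ := hpos
  have hpw : 0 < p w := by
    by_contra h
    have := hw v₀
    simp [gumbelScore, hv₀, (hu v₀).1, h] at this
  have hmax : gumbelMax p u ≤ u w ^ (1 / p w) := by
    rw [gumbelMax_le_iff]
    intro v
    split_ifs with hv
    · have := hw v
      rw [gumbelScore, gumbelScore, if_pos ⟨hv, (hu v).1⟩, if_pos ⟨hpw, (hu w).1⟩,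
        EReal.coe_le_coe_iff] at this
      rw [Real.rpow_def_of_pos (hu v).1, Real.rpow_def_of_pos (hu w).1, mul_one_div, mul_one_div]
      exact Real.exp_le_exp.2 this
    · exact Real.rpow_nonneg (hu w).1.le _
  have ha : 0 < a := hpw.trans_le (hpa w)
  calc gumbelMax p u ^ a ≤ (u w ^ (1 / p w)) ^ a :=
        Real.rpow_le_rpow (gumbelMax_nonneg fun v => (hu v).1.le) hmax ha.le
    _ = u w ^ (1 / p w * a) := (Real.rpow_mul (hu w).1.le _ _).symm
    _ ≤ u w ^ (1 : ℝ) := by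
        refine Real.rpow_le_rpow_of_exponent_ge (hu w).1 (hu w).2.le ?_
        rw [one_div, inv_mul_eq_div, one_le_div hpw]
        exact hpa w
    _ = u w := Real.rpow_one _

/-! ### Calibrators and the choice of the betting fraction -/

/-- The restriction of `g` to `(0,1]`, extended by zero. Unlike `g` itself, it is measurable when
`g` is a calibrator. -/
def unitPart (g : ℝ → ℝ) : ℝ → ℝ := (Set.Ioc (0 : ℝ) 1).indicator g

lemma unitPart_of_mem {g : ℝ → ℝ} {x : ℝ} (hx : x ∈ Set.Ioc (0 : ℝ) 1) : unitPart g x = g x :=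
  Set.indicator_of_mem hx g

lemma IsCalibrator.unitPart_nonneg {g : ℝ → ℝ} (hg : IsCalibrator g) (x : ℝ) :
    0 ≤ unitPart g x :=
  Set.indicator_nonneg (fun p hp => hg.nonneg p ⟨hp.1.le, hp.2⟩) x

lemma IsCalibrator.measurable_unitPart {g : ℝ → ℝ} (hg : IsCalibrator g) :
    Measurable (unitPart g) := by
  refine measurable_of_restrict_of_restrict_compl (s := Set.Ioc (0 : ℝ) 1) measurableSet_Ioc ?_ ?_
  · have h : Antitone ((Set.Ioc (0 : ℝ) 1).domRestrict (unitPart g)) := fun x y hxy => by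
      rw [Set.domRestrict_apply, Set.domRestrict_apply, unitPart_of_mem x.2, unitPart_of_mem y.2]
      exact hg.antitone x.2 y.2 hxy
    exact h.measurable
  · have h : (Set.Ioc (0 : ℝ) 1)ᶜ.domRestrict (unitPart g) = fun _ => 0 :=
      funext fun x => Set.indicator_of_notMem x.2 g
    rw [h]
    exact measurable_const

lemma IsCalibrator.lintegral_unitPart {g : ℝ → ℝ} (hg : IsCalibrator g) :
    ∫⁻ v in Set.Icc (0 : ℝ) 1, ENNReal.ofReal (unitPart g (1 - v)) = 1 := by
  have hint : IntegrableOn g (Set.Icc 0 1) := by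
    by_contra h
    have := integral_undef h
    rw [hg.integral_eq_one] at this
    exact one_ne_zero this
  have hmp : MeasurePreserving (fun v : ℝ => 1 - v) volume volume :=
    Measure.measurePreserving_sub_left volume 1
  have hpre : (fun v : ℝ => 1 - v) ⁻¹' Set.Icc 0 1 = Set.Icc 0 1 := by
    ext v
    simp only [Set.mem_preimage, Set.mem_Icc]
    constructor <;> rintro ⟨h1, h2⟩ <;> constructor <;> linarith
  have hmr := hmp.restrict_preimage (s := Set.Icc (0 : ℝ) 1) measurableSet_Icc
  rw [hpre] at hmr
  rw [hmr.lintegral_comp (f := fun x => ENNReal.ofReal (unitPart g x))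
    hg.measurable_unitPart.ennreal_ofReal]
  have hae : ∀ᵐ x ∂(volume.restrict (Set.Icc (0 : ℝ) 1)), unitPart g x = g x := by
    filter_upwards [ae_restrict_Icc_mem_Ioo] with x hx
    exact unitPart_of_mem ⟨hx.1, hx.2.le⟩
  rw [lintegral_congr_ae (hae.mono fun x hx => by rw [hx]),
    ← ofReal_integral_eq_lintegral_ofReal hint, hg.integral_eq_one, ENNReal.ofReal_one]
  filter_upwards [ae_restrict_mem measurableSet_Icc] with x hx using hg.nonneg x hx

lemma rpow_mem_Ioo {v a : ℝ} (hv : v ∈ Set.Ioo (0 : ℝ) 1) (ha : 0 < a) :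
    v ^ a ∈ Set.Ioo (0 : ℝ) 1 :=
  ⟨Real.rpow_pos_of_pos hv.1 a, Real.rpow_lt_one hv.1.le hv.2 ha⟩

lemma one_sub_mem_Ioc {v : ℝ} (hv : v ∈ Set.Ioo (0 : ℝ) 1) : 1 - v ∈ Set.Ioc (0 : ℝ) 1 :=
  ⟨by linarith [hv.2], by linarith [hv.1]⟩

/-- A nonconstant calibrator has a threshold `c`: values to the left of `c` strictly exceed
values to the right of `c`. -/
lemma IsCalibrator.exists_threshold {g : ℝ → ℝ} (hg : IsCalibrator g)
    (hne : NonconstantOnUnit g) :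
    ∃ c ∈ Set.Ioo (0 : ℝ) 1, ∀ x y, 0 < x → x < c → c < y → y ≤ 1 → g y < g x := by
  obtain ⟨p, hp, q, hq, hpq⟩ := hne
  wlog hlt : p < q generalizing p q
  · refine this q hq p hp hpq.symm (lt_of_le_of_ne (not_lt.1 hlt) ?_)
    rintro rfl
    exact hpq rfl
  have hpq' : g q < g p :=
    lt_of_le_of_ne (hg.antitone ⟨hp.1, hp.2.le⟩ ⟨hq.1, hq.2.le⟩ hlt.le) hpq.symm
  set S : Set ℝ := {x | x ∈ Set.Icc p q ∧ g q < g x} with hS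
  have hpS : p ∈ S := ⟨⟨le_rfl, hlt.le⟩, hpq'⟩
  have hbdd : BddAbove S := ⟨q, fun x hx => hx.1.2⟩
  have hpc : p ≤ sSup S := le_csSup hbdd hpS
  have hcq : sSup S ≤ q := csSup_le ⟨p, hpS⟩ fun x hx => hx.1.2
  refine ⟨sSup S, ⟨hp.1.trans_le hpc, hcq.trans_lt hq.2⟩, fun x y hx hxc hcy hy => ?_⟩
  obtain ⟨z, hz, hxz⟩ := exists_lt_of_lt_csSup ⟨p, hpS⟩ hxc
  have h1 : g z ≤ g x := hg.antitone ⟨hx, hxz.le.trans (hz.1.2.trans hq.2.le)⟩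
    ⟨hx.trans hxz, hz.1.2.trans hq.2.le⟩ hxz.le
  have h2 : g y ≤ g q := by
    rcases le_total q y with h | h
    · exact hg.antitone ⟨hq.1, hq.2.le⟩ ⟨hq.1.trans_le h, hy⟩ h
    · by_contra hlt'
      exact absurd (le_csSup hbdd ⟨⟨hpc.trans hcy.le, h⟩, not_le.1 hlt'⟩) (not_le.2 hcy)
  linarith [hz.2]

/-- Replacing the uniform variable `v` by the larger `v ^ a` strictly increases the mean of a
nonconstant calibrator. -/
lemma IsCalibrator.one_lt_lintegral {g : ℝ → ℝ} (hg : IsCalibrator g)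
    (hne : NonconstantOnUnit g) {a : ℝ} (ha0 : 0 < a) (ha1 : a < 1) :
    1 < ∫⁻ v in Set.Icc (0 : ℝ) 1, ENNReal.ofReal (unitPart g (1 - v ^ a)) := by
  obtain ⟨c, hc, hcg⟩ := hg.exists_threshold hne
  have hmeas : Measurable fun v : ℝ => unitPart g (1 - v ^ a) :=
    hg.measurable_unitPart.comp (by fun_prop)
  rw [← hg.lintegral_unitPart]
  have hd : 1 - c ∈ Set.Ioo (0 : ℝ) 1 := ⟨by linarith [hc.2], by linarith [hc.1]⟩
  -- On this interval `1 - v ^ a < c < 1 - v`.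
  set s : Set ℝ := Set.Ioo ((1 - c) ^ a⁻¹) (1 - c) with hs
  have hs0 : 0 < (1 - c) ^ a⁻¹ := Real.rpow_pos_of_pos hd.1 _
  have hs_lt : (1 - c) ^ a⁻¹ < 1 - c := by
    conv_rhs => rw [← Real.rpow_one (1 - c)]
    exact Real.rpow_lt_rpow_of_exponent_gt hd.1 hd.2 ((one_lt_inv₀ ha0).2 ha1)
  refine lintegral_strict_mono_of_ae_le_of_ae_lt_on hmeas.ennreal_ofReal.aemeasurable
    (by rw [hg.lintegral_unitPart]; exact ENNReal.one_ne_top) ?_ (s := s) ?_ ?_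
  · filter_upwards [ae_restrict_Icc_mem_Ioo] with v hv
    have h1 := one_sub_mem_Ioc hv
    have h2 := one_sub_mem_Ioc (rpow_mem_Ioo hv ha0)
    rw [unitPart_of_mem h1, unitPart_of_mem h2]
    refine ENNReal.ofReal_le_ofReal (hg.antitone h2 h1 (sub_le_sub_left ?_ 1))
    conv_lhs => rw [← Real.rpow_one v]
    exact Real.rpow_le_rpow_of_exponent_ge hv.1 hv.2.le ha1.le
  · rw [Measure.restrict_apply measurableSet_Ioo, Set.inter_eq_left.2, Real.volume_Ioo]
    · exact (ENNReal.ofReal_pos.2 (sub_pos.2 hs_lt)).ne'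
    · exact fun v hv => ⟨(hs0.trans hv.1).le, (hv.2.trans hd.2).le⟩
  · filter_upwards [ae_restrict_Icc_mem_Ioo] with v hv hvs
    have h1 := one_sub_mem_Ioc hv
    have h2 := one_sub_mem_Ioc (rpow_mem_Ioo hv ha0)
    rw [unitPart_of_mem h1, unitPart_of_mem h2]
    have hva : 1 - c < v ^ a := (Real.rpow_inv_lt_iff_of_pos hd.1.le hv.1.le ha0).1 hvs.1
    have hlt : g (1 - v) < g (1 - v ^ a) :=
      hcg _ _ h2.1 (by linarith) (by linarith [hvs.2]) h1.2
    exact (ENNReal.ofReal_lt_ofReal_iff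
      ((hg.nonneg _ ⟨h1.1.le, h1.2⟩).trans_lt hlt)).2 hlt

/-- The reciprocal of the one-step betting factor `1 - lam + lam * g (1 - y)`, with `g` replaced by
`unitPart g`. -/
def invFactor (g : ℝ → ℝ) (lam y : ℝ) : ENNReal :=
  ENNReal.ofReal (1 - lam + lam * unitPart g (1 - y))⁻¹

lemma IsCalibrator.measurable_invFactor {g : ℝ → ℝ} (hg : IsCalibrator g) (lam : ℝ) :
    Measurable (invFactor g lam) := by
  have := hg.measurable_unitPart
  unfold invFactor
  fun_prop

lemma IsCalibrator.factor_pos {g : ℝ → ℝ} (hg : IsCalibrator g) {lam : ℝ} (h0 : 0 < lam)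
    (h1 : lam < 1) (y : ℝ) : 0 < 1 - lam + lam * unitPart g (1 - y) := by
  have := mul_nonneg h0.le (hg.unitPart_nonneg (1 - y))
  linarith

lemma IsCalibrator.invFactor_anti {g : ℝ → ℝ} (hg : IsCalibrator g) {lam : ℝ} (h0 : 0 < lam)
    (h1 : lam < 1) {x y : ℝ} (hx : 0 ≤ x) (hxy : x ≤ y) (hy : y < 1) :
    invFactor g lam y ≤ invFactor g lam x := by
  refine ENNReal.ofReal_le_ofReal (inv_anti₀ (hg.factor_pos h0 h1 x) ?_)
  have hx' : 1 - x ∈ Set.Ioc (0 : ℝ) 1 := ⟨by linarith, by linarith⟩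
  have hy' : 1 - y ∈ Set.Ioc (0 : ℝ) 1 := ⟨by linarith, by linarith⟩
  rw [unitPart_of_mem hx', unitPart_of_mem hy']
  have := mul_le_mul_of_nonneg_left (hg.antitone hy' hx' (sub_le_sub_left hxy 1)) h0.le
  linarith

/-- Truncation: the strict gain in mean survives for `min g B` with `B` large. -/
lemma exists_truncation {α : Type*} {mα : MeasurableSpace α} {μ : Measure α} {h : α → ℝ}
    (hm : Measurable h) (h1 : 1 < ∫⁻ v, ENNReal.ofReal (h v) ∂μ) :
    ∃ B : ℕ, 1 < ∫⁻ v, ENNReal.ofReal (min (h v) B) ∂μ := by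
  have hsup : ∫⁻ v, ENNReal.ofReal (h v) ∂μ = ⨆ B : ℕ, ∫⁻ v, ENNReal.ofReal (min (h v) B) ∂μ := by
    rw [← lintegral_iSup (fun B => by fun_prop)]
    · refine lintegral_congr fun v => le_antisymm ?_ ?_
      · obtain ⟨B, hB⟩ := exists_nat_ge (h v)
        refine le_iSup_of_le B ?_
        rw [min_eq_left hB]
      · exact iSup_le fun B => ENNReal.ofReal_le_ofReal (min_le_left _ _)
    · intro B C hBC v
      exact ENNReal.ofReal_le_ofReal (min_le_min_left _ (by exact_mod_cast hBC))
  rw [hsup] at h1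
  exact lt_iSup_iff.1 h1

lemma inv_one_add_le {x : ℝ} (hx : -(1 / 2) ≤ x) : (1 + x)⁻¹ ≤ 1 - x + 2 * x ^ 2 := by
  have hpos : 0 < 1 + x := by linarith
  rw [inv_le_iff_one_le_mul₀' hpos]
  nlinarith [mul_nonneg (sq_nonneg x) (by linarith : 0 ≤ 1 + 2 * x)]

/-- For a small betting fraction the mean reciprocal factor is below `1` at the least favourable
distribution, that of `v ^ a` with `v` uniform. -/
lemma IsCalibrator.exists_lam {g : ℝ → ℝ} (hg : IsCalibrator g)
    (hne : NonconstantOnUnit g) {a : ℝ} (ha0 : 0 < a) (ha1 : a < 1) :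
    ∃ lam : ℝ, 0 < lam ∧ lam < 1 ∧
      ∫⁻ v in Set.Icc (0 : ℝ) 1, invFactor g lam (v ^ a) < 1 := by
  have hmeas : Measurable fun v : ℝ => unitPart g (1 - v ^ a) :=
    hg.measurable_unitPart.comp (by fun_prop)
  obtain ⟨B, hB⟩ := exists_truncation hmeas (hg.one_lt_lintegral hne ha0 ha1)
  set μ := (volume : Measure ℝ).restrict (Set.Icc 0 1) with hμ
  set k : ℝ → ℝ := fun v => min (unitPart g (1 - v ^ a)) B with hk
  have hk0 : ∀ v, 0 ≤ k v := fun v => le_min (hg.unitPart_nonneg _) (Nat.cast_nonneg B)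
  have hkB : ∀ v, k v ≤ B := fun v => min_le_right _ _
  have hkm : Measurable k := hmeas.min measurable_const
  have hki : Integrable k μ :=
    .of_bound hkm.aestronglyMeasurable (B : ℝ) (ae_of_all _ fun v => by
      rw [Real.norm_of_nonneg (hk0 v)]; exact hkB v)
  have hε : 1 < ∫ v, k v ∂μ := by
    rw [← ofReal_integral_eq_lintegral_ofReal hki (ae_of_all _ hk0)] at hB
    simpa using hB
  set ε := ∫ v, k v ∂μ - 1 with hεdef
  have hε0 : 0 < ε := by linarith
  have hC : (0 : ℝ) < B + 1 := by positivity
  -- `lam` is small enough for the expansion of the reciprocal, and for the gain `lam * ε` to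
  -- exceed the quadratic error `2 * lam ^ 2 * (B + 1) ^ 2`.
  obtain ⟨lam, hl0, hl1, hl2⟩ : ∃ lam : ℝ, 0 < lam ∧ lam * (B + 1) ≤ 1 / 2 ∧
      lam * (B + 1) ^ 2 * 4 ≤ ε := by
    refine ⟨min (1 / 2 / (B + 1)) (ε / ((B + 1) ^ 2 * 4)), by positivity, ?_, ?_⟩
    · rw [← le_div_iff₀ hC]
      exact min_le_left _ _
    · rw [mul_assoc, ← le_div_iff₀ (by positivity)]
      exact min_le_right _ _
  have hB0 : (0 : ℝ) ≤ B := Nat.cast_nonneg B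
  have hlam1 : lam < 1 := by nlinarith
  refine ⟨lam, hl0, hlam1, ?_⟩
  have hpt : ∀ v, invFactor g lam (v ^ a) ≤
      ENNReal.ofReal (1 - lam * (k v - 1) + 2 * (lam * (B + 1)) ^ 2) := by
    intro v
    refine ENNReal.ofReal_le_ofReal ?_
    have hx : |lam * (k v - 1)| ≤ lam * (B + 1) := by
      rw [abs_mul, abs_of_pos hl0]
      refine mul_le_mul_of_nonneg_left (abs_le.2 ⟨?_, ?_⟩) hl0.le <;> linarith [hk0 v, hkB v]
    have hx2 : -(1 / 2) ≤ lam * (k v - 1) := by linarith [(abs_le.1 hx).1]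
    calc (1 - lam + lam * unitPart g (1 - v ^ a))⁻¹ ≤ (1 + lam * (k v - 1))⁻¹ := by
          refine inv_anti₀ (by linarith) ?_
          have := mul_le_mul_of_nonneg_left
            (min_le_left (unitPart g (1 - v ^ a)) (B : ℝ)) hl0.le
          simp only [hk]
          linarith
      _ ≤ 1 - lam * (k v - 1) + 2 * (lam * (k v - 1)) ^ 2 := inv_one_add_le hx2
      _ ≤ _ := by
          have := sq_le_sq' (abs_le.1 hx).1 (abs_le.1 hx).2
          linarith
  have hi1 : Integrable (fun v => lam * (k v - 1)) μ :=
    (hki.sub (integrable_const 1)).const_mul lam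
  have hi2 : Integrable (fun v => 1 - lam * (k v - 1)) μ := (integrable_const 1).sub hi1
  calc ∫⁻ v, invFactor g lam (v ^ a) ∂μ
      ≤ ∫⁻ v, ENNReal.ofReal (1 - lam * (k v - 1) + 2 * (lam * (B + 1)) ^ 2) ∂μ :=
        lintegral_mono hpt
    _ = ENNReal.ofReal (∫ v, (1 - lam * (k v - 1) + 2 * (lam * (B + 1)) ^ 2) ∂μ) := by
        refine (ofReal_integral_eq_lintegral_ofReal (hi2.add (integrable_const _))
          (ae_of_all _ fun v => ?_)).symm
        have : lam * (k v - 1) ≤ lam * (B + 1) :=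
          mul_le_mul_of_nonneg_left (by linarith [hkB v]) hl0.le
        have h2 := sq_nonneg (lam * ((B : ℝ) + 1))
        simp only [Pi.zero_apply, Pi.add_apply]
        nlinarith
    _ = ENNReal.ofReal (1 - lam * ε + 2 * (lam * (B + 1)) ^ 2) := by
        rw [integral_add hi2 (integrable_const _), integral_sub (integrable_const _) hi1,
          integral_const_mul, integral_sub hki (integrable_const _)]
        simp [hεdef, hμ]
    _ < 1 := by
        rw [ENNReal.ofReal_lt_one]
        nlinarith [mul_le_mul_of_nonneg_left hl2 hl0.le, mul_pos hl0 hε0]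

/-! ### Exponential decay of the mean reciprocal wealth -/

section Model

variable {Ω : Type*} {mΩ : MeasurableSpace Ω} {Q : Measure Ω}
  {ℱ : Filtration ℕ mΩ} {K : ℕ} {P ζ : ℕ → Ω → Fin K → ℝ} {W : ℕ → Ω → Fin K}
  {g : ℝ → ℝ} {a lam : ℝ}

lemma IsGumbelMaxModel.ae_seed_mem (h : IsGumbelMaxModel Q ℱ P ζ W) (t : ℕ) :
    ∀ᵐ ω ∂Q, ∀ w, ζ (t + 1) ω w ∈ Set.Ioo (0 : ℝ) 1 := by
  have := ae_pi_mem_Ioo K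
  rw [← h.seed_uniform t] at this
  exact ae_of_ae_map (h.measurable_seed t).aemeasurable this

/-- The reciprocal of the wealth `nonadaptive g lam Y T`, built from `unitPart g` so that it is
measurable; the two agree when all `Y s` lie in `(0,1)`. -/
def invWealth (g : ℝ → ℝ) (lam : ℝ) (Y : ℕ → Ω → ℝ) (T : ℕ) (ω : Ω) : ENNReal :=
  ∏ s ∈ Finset.Icc 1 T, invFactor g lam (Y s ω)

lemma IsGumbelMaxModel.measurable_invWealth (h : IsGumbelMaxModel Q ℱ P ζ W)
    (hg : IsCalibrator g) (T : ℕ) : Measurable[ℱ T] (invWealth g lam (pivotal ζ W) T) := by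
  refine Finset.measurable_fun_prod _ fun s hs => ?_
  obtain ⟨hs1, hsT⟩ := Finset.mem_Icc.1 hs
  obtain ⟨t, rfl⟩ := Nat.exists_eq_add_of_le' hs1
  exact (hg.measurable_invFactor lam).comp ((h.adapted t).mono (ℱ.mono hsT) le_rfl)

variable [IsProbabilityMeasure Q] [NeZero K]

/-- Given the past, the Gumbel maximum is uniform on `[0,1]`, in the form of an expectation against
an arbitrary nonnegative variable `Z` of the past. -/
lemma IsGumbelMaxModel.lintegral_gumbelMax (h : IsGumbelMaxModel Q ℱ P ζ W) (t : ℕ)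
    (hP : ∀ᵐ ω ∂Q, P (t + 1) ω ∈ stdSimplex ℝ (Fin K))
    {Z : Ω → ENNReal} (hZ : Measurable[ℱ t] Z) {f : ℝ → ENNReal} (hf : Measurable f) :
    ∫⁻ ω, Z ω * f (gumbelMax (P (t + 1) ω) (ζ (t + 1) ω)) ∂Q =
      (∫⁻ v in Set.Icc (0 : ℝ) 1, f v) * ∫⁻ ω, Z ω ∂Q := by
  have hX : Measurable[ℱ t] fun ω => (Z ω, P (t + 1) ω) := hZ.prodMk (h.predictable t)
  have hXm : Measurable fun ω => (Z ω, P (t + 1) ω) := hX.mono (ℱ.le t) le_rfl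
  have hind : IndepFun (fun ω => (Z ω, P (t + 1) ω)) (ζ (t + 1)) Q :=
    (indep_of_indep_of_le_right (h.seed_indep t) hX.comap_le).symm
  have hlaw := (indepFun_iff_map_prod_eq_prod_map_map hXm.aemeasurable
    (h.measurable_seed t).aemeasurable).1 hind
  have hF : Measurable fun x : (ENNReal × (Fin K → ℝ)) × (Fin K → ℝ) =>
      x.1.1 * f (gumbelMax x.1.2 x.2) :=
    (by fun_prop : Measurable fun x : (ENNReal × (Fin K → ℝ)) × (Fin K → ℝ) => x.1.1).mul
      (hf.comp (measurable_gumbelMax.comp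
        (by fun_prop : Measurable fun x : (ENNReal × (Fin K → ℝ)) × (Fin K → ℝ) =>
          (x.1.2, x.2))))
  have hG : ∀ p : Fin K → ℝ, Measurable (gumbelMax p) := fun p =>
    measurable_gumbelMax.comp (measurable_const.prodMk measurable_id)
  calc ∫⁻ ω, Z ω * f (gumbelMax (P (t + 1) ω) (ζ (t + 1) ω)) ∂Q
      = ∫⁻ x, x.1.1 * f (gumbelMax x.1.2 x.2)
          ∂(Q.map fun ω => ((Z ω, P (t + 1) ω), ζ (t + 1) ω)) :=
        (lintegral_map hF (hXm.prodMk (h.measurable_seed t))).symm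
    _ = ∫⁻ ω, ∫⁻ u, Z ω * f (gumbelMax (P (t + 1) ω) u)
          ∂(Measure.pi fun _ : Fin K => (volume : Measure ℝ).restrict (Set.Icc 0 1)) ∂Q := by
        rw [hlaw, h.seed_uniform t, lintegral_prod _ hF.aemeasurable,
          lintegral_map hF.lintegral_prod_right' hXm]
    _ = ∫⁻ ω, (∫⁻ v in Set.Icc (0 : ℝ) 1, f v) * Z ω ∂Q := by
        refine lintegral_congr_ae ?_
        filter_upwards [hP] with ω hω
        rw [lintegral_const_mul (Z ω) (f := fun u => f (gumbelMax (P (t + 1) ω) u))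
          (hf.comp (hG _)), ← lintegral_map hf (hG _), map_gumbelMax hω,
          mul_comm]
    _ = _ := lintegral_const_mul _ (hZ.mono (ℱ.le t) le_rfl)

lemma IsGumbelMaxModel.lintegral_invWealth_succ_le (h : IsGumbelMaxModel Q ℱ P ζ W)
    (hg : IsCalibrator g) (h0 : 0 < lam) (h1 : lam < 1)
    (hP : ∀ t, 1 ≤ t → ∀ᵐ ω ∂Q, P t ω ∈ simplexDelta K (1 - a)) (T : ℕ) :
    ∫⁻ ω, invWealth g lam (pivotal ζ W) (T + 1) ω ∂Q ≤
      (∫⁻ v in Set.Icc (0 : ℝ) 1, invFactor g lam (v ^ a)) *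
        ∫⁻ ω, invWealth g lam (pivotal ζ W) T ω ∂Q := by
  have hP1 := hP (T + 1) (Nat.le_add_left 1 T)
  rw [← h.lintegral_gumbelMax T (hP1.mono fun ω hω => hω.1) (h.measurable_invWealth hg T)
    (f := fun v => invFactor g lam (v ^ a)) ((hg.measurable_invFactor lam).comp (by fun_prop))]
  refine lintegral_mono_ae ?_
  filter_upwards [hP1, h.ae_seed_mem T, h.token T] with ω hω hu hw
  rw [invWealth, Finset.prod_Icc_succ_top (Nat.le_add_left 1 T)]
  refine mul_le_mul_right ?_ _
  refine hg.invFactor_anti h0 h1 (Real.rpow_nonneg (gumbelMax_nonneg fun v => (hu v).1.le) a) ?_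
    (hu _).2
  exact gumbelMax_rpow_le hω.1 (fun v => by linarith [hω.2 v]) hu hw

lemma IsGumbelMaxModel.lintegral_invWealth_le (h : IsGumbelMaxModel Q ℱ P ζ W)
    (hg : IsCalibrator g) (h0 : 0 < lam) (h1 : lam < 1)
    (hP : ∀ t, 1 ≤ t → ∀ᵐ ω ∂Q, P t ω ∈ simplexDelta K (1 - a)) (T : ℕ) :
    ∫⁻ ω, invWealth g lam (pivotal ζ W) T ω ∂Q ≤
      (∫⁻ v in Set.Icc (0 : ℝ) 1, invFactor g lam (v ^ a)) ^ T := by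
  induction T with
  | zero => simp [invWealth]
  | succ T ih =>
    rw [pow_succ']
    exact (h.lintegral_invWealth_succ_le hg h0 h1 hP T).trans (by gcongr)

/-! ### Exponential growth of the wealth -/

/-- Markov's inequality and the Borel–Cantelli lemma for a nonnegative process whose means decay
geometrically. -/
lemma ae_eventually_lt_pow {α : Type*} {mα : MeasurableSpace α} {μ : Measure α}
    {N : ℕ → α → ENNReal} (hN : ∀ T, AEMeasurable (N T) μ)
    {ρ : ENNReal} (hρ : ρ < 1) (hle : ∀ T, ∫⁻ ω, N T ω ∂μ ≤ ρ ^ T) :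
    ∃ r : ℝ, 0 < r ∧ r < 1 ∧ ∀ᵐ ω ∂μ, ∀ᶠ T in atTop, N T ω < ENNReal.ofReal (r ^ T) := by
  obtain ⟨s, hs1, hs2⟩ := ENNReal.lt_iff_exists_nnreal_btwn.1 hρ
  have hs0 : (s : ENNReal) ≠ 0 := (bot_le.trans_lt hs1).ne'
  have hsum : ∑' T, μ {ω | (s : ENNReal) ^ T ≤ N T ω} ≠ ⊤ := by
    have hq : ρ / s < 1 := by
      rw [ENNReal.div_lt_iff (Or.inl hs0) (Or.inl ENNReal.coe_ne_top), one_mul]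
      exact hs1
    refine ne_top_of_le_ne_top ?_ (ENNReal.tsum_le_tsum (g := fun T => (ρ / s) ^ T) fun T => ?_)
    · rw [ENNReal.tsum_geometric]
      exact ENNReal.inv_ne_top.2 (tsub_pos_of_lt hq).ne'
    · calc μ {ω | (s : ENNReal) ^ T ≤ N T ω} ≤ (∫⁻ ω, N T ω ∂μ) / (s : ENNReal) ^ T :=
            meas_ge_le_lintegral_div (hN T) (pow_ne_zero _ hs0)
              (ENNReal.pow_ne_top ENNReal.coe_ne_top)
        _ ≤ ρ ^ T / (s : ENNReal) ^ T := by gcongr; exact hle T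
        _ = (ρ / s) ^ T := by
            rw [div_eq_mul_inv, div_eq_mul_inv, mul_pow, ENNReal.inv_pow]
  refine ⟨s, ?_, ?_, ?_⟩
  · exact_mod_cast pos_iff_ne_zero.2 hs0
  · exact_mod_cast hs2
  · filter_upwards [ae_eventually_notMem hsum] with ω hω
    filter_upwards [hω] with T hT
    rw [ENNReal.ofReal_pow s.coe_nonneg, ENNReal.ofReal_coe_nnreal]
    exact not_le.1 hT

lemma nonadaptive_pos_and_invWealth_eq (hg : IsCalibrator g) (h0 : 0 < lam) (h1 : lam < 1)
    {Y : ℕ → Ω → ℝ} {ω : Ω} (hY : ∀ t, Y (t + 1) ω ∈ Set.Ioo (0 : ℝ) 1) (T : ℕ) :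
    0 < nonadaptive g lam Y T ω ∧
      invWealth g lam Y T ω = ENNReal.ofReal (nonadaptive g lam Y T ω)⁻¹ := by
  have hfac : ∀ s ∈ Finset.Icc 1 T, unitPart g (1 - Y s ω) = g (1 - Y s ω) := by
    intro s hs
    obtain ⟨t, rfl⟩ := Nat.exists_eq_add_of_le' (Finset.mem_Icc.1 hs).1
    exact unitPart_of_mem (one_sub_mem_Ioc (hY t))
  have hpos : ∀ s ∈ Finset.Icc 1 T, 0 < 1 - lam + lam * g (1 - Y s ω) := by
    intro s hs
    rw [← hfac s hs]
    exact hg.factor_pos h0 h1 _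
  refine ⟨Finset.prod_pos hpos, ?_⟩
  rw [nonadaptive, ← Finset.prod_inv_distrib,
    ENNReal.ofReal_prod_of_nonneg fun s hs => (inv_pos.2 (hpos s hs)).le]
  refine Finset.prod_congr rfl fun s hs => ?_
  rw [invFactor, hfac s hs]

lemma IsGumbelMaxModel.ae_eventually_pow_lt_nonadaptive (h : IsGumbelMaxModel Q ℱ P ζ W)
    (hg : IsCalibrator g) (h0 : 0 < lam) (h1 : lam < 1)
    (hlam : ∫⁻ v in Set.Icc (0 : ℝ) 1, invFactor g lam (v ^ a) < 1)
    (hP : ∀ t, 1 ≤ t → ∀ᵐ ω ∂Q, P t ω ∈ simplexDelta K (1 - a)) :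
    ∃ r : ℝ, 1 < r ∧ ∀ᵐ ω ∂Q, ∀ᶠ T in atTop, r ^ T < nonadaptive g lam (pivotal ζ W) T ω := by
  obtain ⟨r, hr0, hr1, hr⟩ := ae_eventually_lt_pow
    (fun T => ((h.measurable_invWealth hg T).mono (ℱ.le T) le_rfl).aemeasurable) hlam
    (h.lintegral_invWealth_le hg h0 h1 hP)
  refine ⟨r⁻¹, (one_lt_inv₀ hr0).2 hr1, ?_⟩
  filter_upwards [hr, ae_all_iff.2 h.ae_seed_mem] with ω hω hu
  filter_upwards [hω] with T hT
  obtain ⟨hpos, heq⟩ := nonadaptive_pos_and_invWealth_eq hg h0 h1 (Y := pivotal ζ W)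
    (fun t => hu t _) T
  rw [heq, ENNReal.ofReal_lt_ofReal_iff (pow_pos hr0 T), inv_lt_comm₀ hpos (pow_pos hr0 T)] at hT
  rwa [inv_pow]

lemma growthRate_pos {M : ℕ → Ω → ℝ} {r : ℝ} (hr : 1 < r) {ω : Ω}
    (hM : ∀ᶠ T in atTop, r ^ T < M T ω) : 0 < growthRate M ω := by
  have hlog : (0 : EReal) < (Real.log r : EReal) := by exact_mod_cast Real.log_pos hr
  refine hlog.trans_le (le_liminf_of_le (by isBoundedDefault) ?_)
  filter_upwards [hM, eventually_gt_atTop 0] with T hT hT0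
  have hT0' : (0 : ℝ) < T := by exact_mod_cast hT0
  have hrT : 0 < r ^ T := pow_pos (zero_lt_one.trans hr) T
  rw [EReal.coe_le_coe_iff, one_div, inv_mul_eq_div, le_div_iff₀ hT0', mul_comm, ← Real.log_pow]
  exact Real.log_le_log hrT hT.le

lemma isConsistentTest_of_ae_eventually {M : ℕ → Ω → ℝ} {r : ℝ} (hr : 1 < r)
    (hM : ∀ᵐ ω ∂Q, ∀ᶠ T in atTop, r ^ T < M T ω) (α : ℝ) : IsConsistentTest Q M α := by
  set A : ℕ → Set Ω := fun T =>
    {ω | ((1 / α : ℝ) : EReal) ≤ ⨆ t ∈ Finset.Icc 1 T, (M t ω : EReal)} with hA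
  have hmono : Monotone A := by
    intro S T hST ω hω
    change ((1 / α : ℝ) : EReal) ≤ ⨆ t ∈ Finset.Icc 1 S, (M t ω : EReal) at hω
    exact hω.trans (biSup_mono fun t ht => Finset.Icc_subset_Icc_right hST ht)
  have hfull : Q (⋃ T, A T) = 1 := by
    rw [← measure_univ (μ := Q)]
    refine measure_congr (eventuallyEq_univ.2 ?_)
    filter_upwards [hM] with ω hω
    obtain ⟨T, hT, hT1, hTα⟩ := (hω.and ((eventually_ge_atTop 1).and
      ((tendsto_pow_atTop_atTop_of_one_lt hr).eventually_ge_atTop (1 / α)))).exists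
    refine Set.mem_iUnion.2 ⟨T, ?_⟩
    refine le_trans ?_ (le_biSup (fun t => (M t ω : EReal)) (Finset.mem_Icc.2 ⟨hT1, le_rfl⟩))
    exact_mod_cast hTα.trans hT.le
  have := tendsto_measure_iUnion_atTop (μ := Q) hmono
  rwa [hfull] at this

end Model

end Watermark

end

theorem theorem5p1 (δ : ℝ) (hδ : 0 < δ) (g : ℝ → ℝ) (hg : Watermark.IsCalibrator g)
    (hg_nonconst : Watermark.NonconstantOnUnit g) :
    ∃ lam : ℝ, 0 < lam ∧ lam < 1 ∧
      ∀ (K : ℕ), 2 ≤ K → ∀ (m : ℕ) (Ω : Type*) (mΩ : MeasurableSpace Ω)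
        (Q : Measure Ω) [IsProbabilityMeasure Q] (ℱ : Filtration ℕ mΩ)
        (P ζ : ℕ → Ω → Fin K → ℝ) (W : ℕ → Ω → Fin K),
        Watermark.IsGumbelMaxModel Q ℱ P ζ W →
        (∀ t, 1 ≤ t → ∀ᵐ ω ∂Q, P t ω ∈ Watermark.simplexDelta K δ) →
        Watermark.IsMDependent Q m P →
        (∀ᵐ ω ∂Q, 0 < Watermark.growthRate
          (Watermark.nonadaptive g lam (Watermark.pivotal ζ W)) ω) ∧
        ∀ α : ℝ, 0 < α → α < 1 →
          Watermark.IsConsistentTest Q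
            (Watermark.nonadaptive g lam (Watermark.pivotal ζ W)) α := by
  -- For `δ ≥ 1` the set `simplexDelta K δ` is empty; the cap `1 / 2` keeps the exponent positive.
  set d := min δ (1 / 2) with hd
  have hd0 : 0 < d := lt_min hδ (by norm_num)
  have hd1 : d ≤ 1 / 2 := min_le_right _ _
  have ha0 : 0 < 1 - d := by linarith
  obtain ⟨lam, h0, h1, hlam⟩ := hg.exists_lam hg_nonconst ha0 (by linarith)
  refine ⟨lam, h0, h1, fun K hK m Ω mΩ Q _ ℱ P ζ W hmodel hP _ => ?_⟩
  have : NeZero K := ⟨by omega⟩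
  have hP' : ∀ t, 1 ≤ t → ∀ᵐ ω ∂Q, P t ω ∈ Watermark.simplexDelta K (1 - (1 - d)) :=
    fun t ht => (hP t ht).mono fun ω hω =>
      ⟨hω.1, fun w => (hω.2 w).trans (by linarith [min_le_left δ (1 / 2)])⟩
  obtain ⟨r, hr, hM⟩ := hmodel.ae_eventually_pow_lt_nonadaptive hg h0 h1 hlam hP'
  exact ⟨hM.mono fun ω hω => Watermark.growthRate_pos hr hω,
    fun α _ _ => Watermark.isConsistentTest_of_ae_eventually hr hM α⟩
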